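/- All normed linear spaces are real. Let $X,Y$ be normed linear spaces and $C\subset X$ a convex set. A continuous mapping $F\colon C\to Y$ is called *d.c.* if there is a continuous function $f\colon C\to\mathbb R$ such that $y^*\circ F+f$ is convex on $C$ for every $y^*\in Y^*$ with $\|y^*\|\le 1$; such an $f$ is called a *control function* for $F$. A norm $|\cdot|$ on $Y$ has *modulus of convexity of power type 2* if there is $a>0$ with $\delta(\varepsilon)\ge a\varepsilon^2$ for all $\varepsilon\in(0,2]$, where $\delta(\varepsilon)=\inf\{1-|\tfrac{x+y}{2}| : |x|=|y|=1,\ |x-y|\ge\varepsilon\}$ (with $\inf\emptyset=+\infty$). A mapping $G$ from an open set $U\subset Y$ to a normed linear space $Z$ is $C^{1,1}$ on $U$ if it is Fréchet differentiable at each point of $U$ and $G'\colon U\to\mathcal L(Y,Z)$ is Lipschitz on $U$. **Theorem.** Let $X,Y,Z$ be normed linear spaces, let $A\subset X$ and $B\subset Y$ be open convex sets, and let $F\colon A\to B$ and $G\colon B\to Z$ be d.c. mappings. Then $G\circ F$ is d.c. on $A$, provided at least one of the following conditions is satisfied: (a) $B=Y$ and $G$ admits a control function $g$ that is bounded on bounded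 sets; (b) $Y$ is finite-dimensional and $\overline{F(A)}\subset B$; (c) $Y$ admits an equivalent norm with modulus of convexity of power type 2, and $G$ is $C^{1,1}$ on every bounded open subset of $B$. -/

import Mathlib

/-- `f` is a control function for `F` on `C`: `f` is continuous on `C`, and `y* ∘ F + f` is convex
on `C` (in particular `C` is convex) for every continuous linear functional `y*` with `‖y*‖ ≤ 1`. -/
def IsControlFunctionOn {X Y : Type*} [NormedAddCommGroup X] [NormedSpace ℝ X]
    [NormedAddCommGroup Y] [NormedSpace ℝ Y] (f : X → ℝ) (F : X → Y) (C : Set X) : Prop :=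
  ContinuousOn f C ∧
    ∀ φ : StrongDual ℝ Y, ‖φ‖ ≤ 1 → ConvexOn ℝ C (fun x => φ (F x) + f x)

/-- `F` is a d.c. (delta-convex) mapping on `C`: it is continuous on `C` and admits a control
function on `C`. -/
def IsDCOn {X Y : Type*} [NormedAddCommGroup X] [NormedSpace ℝ X]
    [NormedAddCommGroup Y] [NormedSpace ℝ Y] (F : X → Y) (C : Set X) : Prop :=
  ContinuousOn F C ∧ ∃ f : X → ℝ, IsControlFunctionOn f F C

/-- `p` is an equivalent norm on the normed linear space `Y`. -/
def IsEquivalentNorm {Y : Type*} [NormedAddCommGroup Y] [NormedSpace ℝ Y]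
    (p : Seminorm ℝ Y) : Prop :=
  ∃ m M : ℝ, 0 < m ∧ 0 < M ∧ ∀ y : Y, m * ‖y‖ ≤ p y ∧ p y ≤ M * ‖y‖

/-- The classical modulus of convexity `δ(ε) = inf {1 - p ((x + y) / 2) : p x = p y = 1,
p (x - y) ≥ ε}` of the norm `p`. It is taken in the extended reals, so that the infimum over the
empty set is `+∞`. -/
noncomputable def modulusOfConvexity {Y : Type*} [AddCommGroup Y] [Module ℝ Y]
    (p : Seminorm ℝ Y) (ε : ℝ) : EReal :=
  ⨅ (x : Y) (y : Y) (_ : p x = 1) (_ : p y = 1) (_ : ε ≤ p (x - y)),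
    ((1 - p ((1 / 2 : ℝ) • (x + y)) : ℝ) : EReal)

/-- The norm `p` has modulus of convexity of power type 2. -/
def HasConvexityPowerTypeTwo {Y : Type*} [AddCommGroup Y] [Module ℝ Y]
    (p : Seminorm ℝ Y) : Prop :=
  ∃ a : ℝ, 0 < a ∧ ∀ ε : ℝ, 0 < ε → ε ≤ 2 → ((a * ε ^ 2 : ℝ) : EReal) ≤ modulusOfConvexity p ε

/-- `G` is of class `C^{1,1}` on the open set `U`: it is Fréchet differentiable at each point of
`U`, and its derivative is (globally) Lipschitz on `U`. -/
def IsC11On {Y Z : Type*} [NormedAddCommGroup Y] [NormedSpace ℝ Y]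
    [NormedAddCommGroup Z] [NormedSpace ℝ Z] (G : Y → Z) (U : Set Y) : Prop :=
  (∀ y ∈ U, DifferentiableAt ℝ G y) ∧ ∃ K : NNReal, LipschitzOnWith K (fderiv ℝ G) U

/-! Let `g` control `G` and `f` control `F`. The mapping `G ∘ F` is controlled by `g ∘ F + θ ∘ ψ`,
where `ψ = f + c‖· - x₀‖ + c'` dominates `‖F‖` and `θ` is a convex function of fast enough growth.
Midpoint inequalities need checking only near each `x`. With `m` the midpoint of `F (x ± y)`,
convexity of `φ ∘ G + g` bounds the average of its values at `F (x ± y)` below by its value at `m`.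
Passing from `m` to `F x` loses at most `L‖m - F x‖`, and `‖m - F x‖` is at most the midpoint defect
of `ψ`. A subgradient of `θ` at `ψ x` that is at least `L` pays for the loss; since `‖F x‖ ≤ ψ x`,
it can be chosen from `ψ x` alone once `L` is uniform on bounded parts of `F(A)`
(`IsControlFunctionOn.isDCOn_comp`). Such an `L` comes from boundedness in (a), compactness in (b),
and in (c) from the `C^{1,1}` bounds with a control function `θ(p²)`, `p²` being strongly convex. -/

open Filter Topology Set

/-! ### Convexity from local midpoint inequalities. -/

section LocalConvexity

/-- A continuous function on `[0, 1]` which is nonpositive at the endpoints and satisfies the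
midpoint inequality locally at each interior point is nonpositive. -/
lemma nonpos_of_local_midpoint {w : ℝ → ℝ} (hc : ContinuousOn w (Icc 0 1))
    (h0 : w 0 ≤ 0) (h1 : w 1 ≤ 0)
    (hm : ∀ t ∈ Ioo (0 : ℝ) 1, ∀ᶠ s in 𝓝 (0 : ℝ), w t ≤ (w (t + s) + w (t - s)) / 2) :
    ∀ t ∈ Icc (0 : ℝ) 1, w t ≤ 0 := by
  by_contra! hcon
  obtain ⟨t₀, ht₀, hpos⟩ := hcon
  obtain ⟨t₁, ht₁, hmax⟩ := isCompact_Icc.exists_isMaxOn ⟨t₀, ht₀⟩ hc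
  have hM : 0 < w t₁ := hpos.trans_le (hmax ht₀)
  -- At the largest maximiser, a step to the right strictly lowers `w`, against the midpoint
  -- inequality.
  have hS : IsCompact (Icc (0 : ℝ) 1 ∩ w ⁻¹' {w t₁}) :=
    isCompact_Icc.of_isClosed_subset
      (hc.preimage_isClosed_of_isClosed isClosed_Icc isClosed_singleton) inter_subset_left
  obtain ⟨t, ⟨htI, htw⟩, htg⟩ := hS.exists_isGreatest ⟨t₁, ht₁, rfl⟩
  have htw' : w t = w t₁ := htw
  have ht0 : 0 < t := lt_of_le_of_ne htI.1 (by rintro rfl; linarith)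
  have ht1 : t < 1 := lt_of_le_of_ne htI.2 (by rintro rfl; linarith)
  have hsmall : ∀ᶠ s in 𝓝 (0 : ℝ), s < min t (1 - t) :=
    gt_mem_nhds (lt_min ht0 (by linarith))
  obtain ⟨s, ⟨hs1, hs2⟩, hs0⟩ := (((hm t ⟨ht0, ht1⟩).and hsmall).filter_mono
    (nhdsWithin_le_nhds (s := Ioi 0)) |>.and self_mem_nhdsWithin).exists
  have hs0' : 0 < s := hs0
  have hst := lt_min_iff.1 hs2
  have hp : t + s ∈ Icc (0 : ℝ) 1 := ⟨by linarith, by linarith [hst.2]⟩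
  have hq : t - s ∈ Icc (0 : ℝ) 1 := ⟨by linarith [hst.1], by linarith⟩
  have hle1 : w (t + s) ≤ w t₁ := hmax hp
  have hle2 : w (t - s) ≤ w t₁ := hmax hq
  have hne : w (t + s) ≠ w t₁ := fun h => by
    have : t + s ≤ t := htg ⟨hp, h⟩
    linarith
  have := lt_of_le_of_ne hle1 hne
  linarith

/-- A continuous function on an open convex set is convex as soon as it satisfies the midpoint
inequality locally at each point. -/
lemma convexOn_of_local_midpoint {X : Type*} [NormedAddCommGroup X] [NormedSpace ℝ X]
    {A : Set X} (hA : Convex ℝ A) {v : X → ℝ} (hc : ContinuousOn v A)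
    (hm : ∀ x ∈ A, ∀ᶠ y in 𝓝 (0 : X), v x ≤ (v (x + y) + v (x - y)) / 2) :
    ConvexOn ℝ A v := by
  refine ⟨hA, fun x hx y hy a b ha hb hab => ?_⟩
  have hseg : ∀ t ∈ Icc (0 : ℝ) 1, x + t • (y - x) ∈ A := fun t ht =>
    hA.add_smul_sub_mem hx hy ht
  have key := nonpos_of_local_midpoint
    (w := fun t => v (x + t • (y - x)) - (v x + t * (v y - v x))) ?_ (by simp) (by simp) ?_
    b ⟨hb, by linarith⟩
  · have hpt : a • x + b • y = x + b • (y - x) := by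
      rw [← eq_sub_iff_add_eq] at hab
      subst hab
      module
    rw [hpt]
    simp only [smul_eq_mul]
    have : a = 1 - b := by linarith
    subst this
    linarith
  · refine ContinuousOn.sub (hc.comp (by fun_prop) hseg) (by fun_prop)
  · intro t ht
    have hcont : Tendsto (fun s : ℝ => s • (y - x)) (𝓝 0) (𝓝 0) := by
      have : Continuous fun s : ℝ => s • (y - x) := by fun_prop
      simpa using this.tendsto 0
    filter_upwards [hcont.eventually (hm _ (hseg t ⟨ht.1.le, ht.2.le⟩))] with s hs
    have e1 : x + t • (y - x) + s • (y - x) = x + (t + s) • (y - x) := by module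
    have e2 : x + t • (y - x) - s • (y - x) = x + (t - s) • (y - x) := by module
    rw [e1, e2] at hs
    linarith

end LocalConvexity

/-- For every sequence `L` there is a continuous convex function on the line whose subgradient at
`t` is at least `L ⌈t⌉₊`. -/
lemma exists_continuous_large_subgradient (L : ℕ → ℝ) :
    ∃ θ k : ℝ → ℝ, Continuous θ ∧ Monotone k ∧ (∀ t, 0 ≤ k t) ∧ (∀ t, L ⌈t⌉₊ ≤ k t) ∧
      ∀ t s, θ t + k t * (s - t) ≤ θ s := by
  -- Partial sums of `|L i|` make `k` monotone, so its primitive is convex; the `+ 1` includes the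
  -- index `⌈t⌉₊` itself.
  set k : ℝ → ℝ := fun t => ∑ i ∈ Finset.range (⌈t⌉₊ + 1), |L i| with hk
  have hmono : Monotone k := fun s t hst => by
    refine Finset.sum_le_sum_of_subset_of_nonneg ?_ fun _ _ _ => abs_nonneg _
    exact Finset.range_mono (Nat.add_le_add_right (Nat.ceil_mono hst) 1)
  have hint : ∀ a b, IntervalIntegrable k MeasureTheory.volume a b := fun a b =>
    hmono.intervalIntegrable
  refine ⟨fun t => ∫ x in (0 : ℝ)..t, k x, k, intervalIntegral.continuous_primitive hint 0, hmono,
    fun t => Finset.sum_nonneg fun _ _ => abs_nonneg _, fun t => ?_, fun t s => ?_⟩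
  · exact (le_abs_self _).trans (Finset.single_le_sum (f := fun i => |L i|)
      (fun _ _ => abs_nonneg _) (Finset.mem_range.2 (Nat.lt_succ_self _)))
  · have hsub : (∫ x in (0 : ℝ)..s, k x) - ∫ x in (0 : ℝ)..t, k x = ∫ x in t..s, k x :=
      intervalIntegral.integral_interval_sub_left (hint _ _) (hint _ _)
    suffices k t * (s - t) ≤ ∫ x in t..s, k x by simp only; linarith
    rcases le_total t s with hts | hst
    · have := intervalIntegral.integral_mono_on (f := fun _ => k t) hts
        intervalIntegrable_const (hint t s) fun x hx => hmono hx.1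
      simp only [intervalIntegral.integral_const, smul_eq_mul] at this
      linarith
    · have := intervalIntegral.integral_mono_on (g := fun _ => k t) hst
        (hint s t) intervalIntegrable_const fun x hx => hmono hx.2
      simp only [intervalIntegral.integral_const, smul_eq_mul] at this
      rw [intervalIntegral.integral_symm]
      linarith

/-! ### Growth and Lipschitz estimates; the composition principle; cases (a) and (b). -/

section Control

variable {X Y Z : Type*} [NormedAddCommGroup X] [NormedSpace ℝ X]
  [NormedAddCommGroup Y] [NormedSpace ℝ Y] [NormedAddCommGroup Z] [NormedSpace ℝ Z]

lemma norm_le_of_forall_dual_le {y : Y} {c : ℝ}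
    (h : ∀ φ : StrongDual ℝ Y, ‖φ‖ ≤ 1 → φ y ≤ c) : ‖y‖ ≤ c := by
  obtain ⟨φ, hφ, hy⟩ := exists_dual_vector'' ℝ y
  have := h φ hφ
  rwa [hy] at this

lemma abs_dual_le_norm {φ : StrongDual ℝ Y} (hφ : ‖φ‖ ≤ 1) (y : Y) : |φ y| ≤ ‖y‖ := by
  simpa using φ.le_of_opNorm_le hφ y

lemma IsControlFunctionOn.convexOn {f : X → ℝ} {F : X → Y} {C : Set X}
    (h : IsControlFunctionOn f F C) : ConvexOn ℝ C f := by
  simpa using h.2 0 (by simp)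

/-- The defect of midpoint affinity of a d.c. mapping is at most that of its control function. -/
lemma IsControlFunctionOn.norm_midpoint_sub_le {f : X → ℝ} {F : X → Y} {C : Set X}
    (h : IsControlFunctionOn f F C) {x y : X} (h₁ : x + y ∈ C) (h₂ : x - y ∈ C) :
    ‖(1 / 2 : ℝ) • (F (x + y) + F (x - y)) - F x‖ ≤ (f (x + y) + f (x - y)) / 2 - f x := by
  refine norm_le_of_forall_dual_le fun φ hφ => ?_
  have := (h.2 (-φ) (by rwa [norm_neg])).2 h₁ h₂ (by norm_num : (0 : ℝ) ≤ 1 / 2)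
    (by norm_num : (0 : ℝ) ≤ 1 / 2) (by norm_num)
  have e : (1 / 2 : ℝ) • (x + y) + (1 / 2 : ℝ) • (x - y) = x := by module
  rw [e] at this
  simp only [neg_apply, smul_eq_mul, map_sub, map_smul, map_add] at this ⊢
  linarith

/-- A d.c. mapping on an open convex set grows at most like its control function plus a multiple
of the norm. -/
lemma IsControlFunctionOn.exists_norm_le {f : X → ℝ} {F : X → Y} {C : Set X}
    (h : IsControlFunctionOn f F C) (hF : ContinuousOn F C) (hC : IsOpen C) {x₀ : X}
    (hx₀ : x₀ ∈ C) :
    ∃ c c' : ℝ, 0 ≤ c ∧ ∀ x ∈ C, ‖F x‖ ≤ f x + (c * ‖x - x₀‖ + c') := by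
  have hcF : ContinuousAt F x₀ := hF.continuousAt (hC.mem_nhds hx₀)
  have hcf : ContinuousAt f x₀ := h.1.continuousAt (hC.mem_nhds hx₀)
  set M : ℝ := max ‖F x₀‖ |f x₀| + 1 with hM
  have hM0 : 0 ≤ M := by positivity
  have e1 : ∀ᶠ x in 𝓝 x₀, ‖F x‖ < M :=
    hcF.norm.eventually_lt_const (lt_of_le_of_lt (le_max_left _ _) (lt_add_one _))
  have e2 : ∀ᶠ x in 𝓝 x₀, |f x| < M :=
    hcf.abs.eventually_lt_const (lt_of_le_of_lt (le_max_right _ _) (lt_add_one _))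
  obtain ⟨r, hr, hball⟩ := Metric.eventually_nhds_iff.1 (e1.and (e2.and (hC.mem_nhds hx₀)))
  refine ⟨8 * M / r, 8 * M / r + 2 * M, by positivity, fun x hx => ?_⟩
  set d := ‖x - x₀‖ with hd
  have hd0 : 0 ≤ d := norm_nonneg _
  -- `x₀` is a convex combination of `x` and a point `x₀ - ε • (x - x₀)` of the ball. Convexity of
  -- `f - φ ∘ F` yields `φ (F x) - f x ≤ 4M/ε + 2M`, which is affine in `d`.
  set ε : ℝ := r / (2 * (d + 1)) with hε
  have hε0 : 0 < ε := by positivity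
  have hεd : ε * d < r := by
    rw [hε, div_mul_eq_mul_div, div_lt_iff₀ (by positivity)]
    nlinarith
  obtain ⟨hF', hf', hC'⟩ := hball (y := x₀ - ε • (x - x₀)) (by
    rw [dist_eq_norm, sub_sub_cancel_left, norm_neg, norm_smul, Real.norm_of_nonneg hε0.le]
    exact hεd)
  obtain ⟨hF₀, hf₀, -⟩ := hball (y := x₀) (by simpa using hr)
  refine norm_le_of_forall_dual_le fun φ hφ => ?_
  have hconv := (h.2 (-φ) (by rwa [norm_neg])).2 hC' hx
    (by positivity : (0 : ℝ) ≤ 1 / (1 + ε)) (by positivity : (0 : ℝ) ≤ ε / (1 + ε))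
    (by field_simp)
  have hpt : (1 / (1 + ε)) • (x₀ - ε • (x - x₀)) + (ε / (1 + ε)) • x = x₀ := by
    have : (1 + ε) ≠ 0 := by positivity
    match_scalars <;> field_simp <;> ring
  rw [hpt] at hconv
  simp only [neg_apply, smul_eq_mul] at hconv
  have hconv' : (1 + ε) * (-φ (F x₀) + f x₀) ≤
      (-φ (F (x₀ - ε • (x - x₀))) + f (x₀ - ε • (x - x₀))) + ε * (-φ (F x) + f x) := by
    have := mul_le_mul_of_nonneg_left hconv (by positivity : (0 : ℝ) ≤ 1 + ε)
    refine this.trans_eq ?_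
    field_simp
  have b1 := abs_le.1 ((abs_dual_le_norm hφ (F (x₀ - ε • (x - x₀)))).trans hF'.le)
  have b2 := abs_le.1 ((abs_dual_le_norm hφ (F x₀)).trans hF₀.le)
  have b3 := abs_le.1 hf'.le
  have b4 := abs_le.1 hf₀.le
  have hmain : ε * φ (F x) ≤ ε * (f x + (8 * M / r * d + (8 * M / r + 2 * M))) := by
    have : ε * (8 * M / r * d + (8 * M / r + 2 * M)) = 4 * M + ε * (2 * M) := by
      rw [hε]; field_simp; ring
    rw [mul_add, this]
    nlinarith
  exact le_of_mul_le_mul_left hmain hε0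

/-- Composition of d.c. mappings, when the convex functions `φ ∘ G + g` are one-sidedly locally
Lipschitz at the values of `F`, uniformly on bounded sets. -/
theorem IsControlFunctionOn.isDCOn_comp {A : Set X} {B : Set Y} (hA : IsOpen A)
    (hAconv : Convex ℝ A) {F : X → Y} {G : Y → Z} (hFAB : MapsTo F A B) (hF : IsDCOn F A)
    (hG : ContinuousOn G B) {g : Y → ℝ} (hg : IsControlFunctionOn g G B)
    (hL : ∀ R : ℝ, ∃ L : ℝ, ∀ b ∈ F '' A, ‖b‖ ≤ R → ∀ᶠ y in 𝓝 b,
      ∀ φ : StrongDual ℝ Z, ‖φ‖ ≤ 1 → φ (G b) + g b - (φ (G y) + g y) ≤ L * ‖y - b‖) :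
    IsDCOn (G ∘ F) A := by
  obtain ⟨hFc, f, hf⟩ := hF
  refine ⟨hG.comp hFc hFAB, ?_⟩
  rcases A.eq_empty_or_nonempty with rfl | ⟨x₀, hx₀⟩
  · exact ⟨0, continuousOn_empty _, fun φ _ => ⟨convex_empty, by simp⟩⟩
  obtain ⟨c, c', hc, hbound⟩ := hf.exists_norm_le hFc hA hx₀
  choose L hL using fun n : ℕ => hL n
  obtain ⟨θ, k, hθ, -, hk0, hkL, hsub⟩ := exists_continuous_large_subgradient L
  set ψ : X → ℝ := fun x => f x + (c * ‖x - x₀‖ + c') with hψ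
  have hψc : ContinuousOn ψ A := hf.1.add (by fun_prop)
  have hcont : ContinuousOn (fun x => g (F x) + θ (ψ x)) A :=
    (hg.1.comp hFc hFAB).add (hθ.comp_continuousOn hψc)
  refine ⟨fun x => g (F x) + θ (ψ x), hcont, fun φ hφ => ?_⟩
  refine convexOn_of_local_midpoint hAconv
    ((φ.continuous.comp_continuousOn (hG.comp hFc hFAB)).add hcont) fun x hx => ?_
  have hadd : Tendsto (fun y => x + y) (𝓝 0) (𝓝 x) := by
    exact Continuous.tendsto' (by fun_prop) _ _ (by simp)
  have hsubt : Tendsto (fun y => x - y) (𝓝 0) (𝓝 x) := by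
    exact Continuous.tendsto' (by fun_prop) _ _ (by simp)
  have hFx : Tendsto F (𝓝 x) (𝓝 (F x)) := hFc.continuousAt (hA.mem_nhds hx)
  have havg : Tendsto (fun y => (1 / 2 : ℝ) • (F (x + y) + F (x - y))) (𝓝 0) (𝓝 (F x)) := by
    have := ((hFx.comp hadd).add (hFx.comp hsubt)).const_smul (1 / 2 : ℝ)
    have e : (1 / 2 : ℝ) • (F x + F x) = F x := by module
    rwa [e] at this
  have hn : ‖F x‖ ≤ (⌈ψ x⌉₊ : ℝ) := (hbound x hx).trans (Nat.le_ceil _)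
  filter_upwards [hadd.eventually (hA.mem_nhds hx), hsubt.eventually (hA.mem_nhds hx),
    havg.eventually (hL _ (F x) ⟨x, hx, rfl⟩ hn)] with y hy₁ hy₂ hy
  have hmid := hf.norm_midpoint_sub_le hy₁ hy₂
  have hnorm : ‖x - x₀‖ ≤ (‖x + y - x₀‖ + ‖x - y - x₀‖) / 2 := by
    have e : x - x₀ = (1 / 2 : ℝ) • ((x + y - x₀) + (x - y - x₀)) := by module
    have := norm_add_le (x + y - x₀) (x - y - x₀)
    rw [e, norm_smul]
    norm_num
    linarith
  have hψmid : ‖(1 / 2 : ℝ) • (F (x + y) + F (x - y)) - F x‖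
      ≤ (ψ (x + y) + ψ (x - y)) / 2 - ψ x := by
    have := mul_le_mul_of_nonneg_left hnorm hc
    simp only [hψ]
    linarith
  have hk := (mul_le_mul_of_nonneg_right (hkL (ψ x)) (norm_nonneg _)).trans
    (mul_le_mul_of_nonneg_left hψmid (hk0 (ψ x)))
  have hconv := (hg.2 φ hφ).2 (hFAB hy₁) (hFAB hy₂) (by norm_num : (0 : ℝ) ≤ 1 / 2)
    (by norm_num : (0 : ℝ) ≤ 1 / 2) (by norm_num)
  rw [← smul_add] at hconv
  simp only [smul_eq_mul] at hconv
  have h1 := hsub (ψ x) (ψ (x + y))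
  have h2 := hsub (ψ x) (ψ (x - y))
  have h3 := hy φ hφ
  simp only [Function.comp_apply]
  linarith

/-- If a d.c. mapping and its control function are bounded on a ball, then the associated convex
functions are one-sidedly Lipschitz at the centre of the ball. -/
lemma IsControlFunctionOn.sub_le_of_bounded {g : Y → ℝ} {G : Y → Z} {B : Set Y}
    (hg : IsControlFunctionOn g G B) {b y : Y} {δ M : ℝ} (hδ : 0 < δ)
    (hB : Metric.closedBall b δ ⊆ B)
    (hM : ∀ x ∈ Metric.closedBall b δ, ‖G x‖ ≤ M ∧ |g x| ≤ M) (hy : ‖y - b‖ ≤ δ)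
    {φ : StrongDual ℝ Z} (hφ : ‖φ‖ ≤ 1) :
    φ (G b) + g b - (φ (G y) + g y) ≤ 4 * M / δ * ‖y - b‖ := by
  rcases eq_or_ne y b with rfl | hne
  · simp
  have hd : 0 < ‖y - b‖ := norm_pos_iff.2 (sub_ne_zero.2 hne)
  -- The ray from `y` through `b` is extended to the sphere of radius `δ`; convexity there bounds
  -- the drop from `b` to `y` by `t` times the oscillation `4M`.
  set t : ℝ := ‖y - b‖ / δ with ht
  have ht0 : 0 < t := by positivity
  have hzb : b - t⁻¹ • (y - b) ∈ Metric.closedBall b δ := by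
    rw [mem_closedBall_iff_norm, sub_sub_cancel_left, norm_neg, norm_smul, norm_inv,
      Real.norm_of_nonneg ht0.le, ht]
    exact le_of_eq (by field_simp)
  have hyb : y ∈ Metric.closedBall b δ := mem_closedBall_iff_norm.2 hy
  have hconv := (hg.2 φ hφ).2 (hB hyb) (hB hzb)
    (by positivity : (0 : ℝ) ≤ 1 / (1 + t)) (by positivity : (0 : ℝ) ≤ t / (1 + t))
    (by field_simp)
  have hpt : (1 / (1 + t)) • y + (t / (1 + t)) • (b - t⁻¹ • (y - b)) = b := by
    have : (1 + t) ≠ 0 := by positivity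
    match_scalars <;> field_simp <;> ring
  rw [hpt] at hconv
  simp only [smul_eq_mul] at hconv
  set z := b - t⁻¹ • (y - b)
  have hbb : b ∈ Metric.closedBall b δ := Metric.mem_closedBall_self hδ.le
  have hconv' : (1 + t) * (φ (G b) + g b) ≤ (φ (G y) + g y) + t * (φ (G z) + g z) := by
    refine (mul_le_mul_of_nonneg_left hconv (by positivity : (0 : ℝ) ≤ 1 + t)).trans_eq ?_
    field_simp
  have b1 := abs_le.1 ((abs_dual_le_norm hφ (G z)).trans (hM z hzb).1)
  have b2 := abs_le.1 ((abs_dual_le_norm hφ (G b)).trans (hM b hbb).1)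
  have b3 := abs_le.1 (hM z hzb).2
  have b4 := abs_le.1 (hM b hbb).2
  have e : 4 * M / δ * ‖y - b‖ = t * (4 * M) := by rw [ht]; field_simp
  rw [e]
  nlinarith

lemma IsControlFunctionOn.exists_sub_le_of_bounded {g : Y → ℝ} {G : Y → Z} {B S : Set Y}
    (hg : IsControlFunctionOn g G B) {δ M : ℝ} (hδ : 0 < δ)
    (hB : ∀ b ∈ S, Metric.closedBall b δ ⊆ B)
    (hM : ∀ b ∈ S, ∀ x ∈ Metric.closedBall b δ, ‖G x‖ ≤ M ∧ |g x| ≤ M) :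
    ∃ L : ℝ, ∀ b ∈ S, ∀ᶠ y in 𝓝 b, ∀ φ : StrongDual ℝ Z, ‖φ‖ ≤ 1 →
      φ (G b) + g b - (φ (G y) + g y) ≤ L * ‖y - b‖ := by
  refine ⟨4 * M / δ, fun b hb => ?_⟩
  filter_upwards [Metric.closedBall_mem_nhds b hδ] with y hy φ hφ
  exact hg.sub_le_of_bounded hδ (hB b hb) (hM b hb) (mem_closedBall_iff_norm.1 hy) hφ

lemma isDCOn_comp_of_bounded_control {A : Set X} (hA : IsOpen A) (hAconv : Convex ℝ A)
    {F : X → Y} {G : Y → Z} (hF : IsDCOn F A) (hG : ContinuousOn G univ) {g : Y → ℝ}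
    (hg : IsControlFunctionOn g G univ)
    (hb : ∀ S : Set Y, Bornology.IsBounded S → Bornology.IsBounded (g '' S)) :
    IsDCOn (G ∘ F) A := by
  refine hg.isDCOn_comp hA hAconv (mapsTo_univ _ _) hF hG fun R => ?_
  obtain ⟨c, c', hc, hbound⟩ := hg.exists_norm_le hG isOpen_univ (mem_univ 0)
  obtain ⟨N, hN⟩ := isBounded_iff_forall_norm_le.1
    (hb _ (Metric.isBounded_closedBall (x := (0 : Y)) (r := R + 1)))
  -- The growth estimate turns the bound on `g` over the ball of radius `R + 1` into one on `G`.
  obtain ⟨L, hL⟩ := hg.exists_sub_le_of_bounded (S := Metric.closedBall 0 R) (δ := 1)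
    (M := |N| + (c * |R + 1| + |c'|)) one_pos (fun _ _ => subset_univ _) fun b hbR x hx => by
      have hxR : ‖x‖ ≤ R + 1 := by
        have h1 := mem_closedBall_iff_norm.1 hx
        have h2 := mem_closedBall_zero_iff.1 hbR
        have h3 := norm_add_le (x - b) b
        rw [sub_add_cancel] at h3
        linarith
      have hgx : |g x| ≤ N := hN _ ⟨x, mem_closedBall_zero_iff.2 hxR, rfl⟩
      have hGx := hbound x (mem_univ x)
      rw [sub_zero] at hGx
      have h4 := mul_le_mul_of_nonneg_left (hxR.trans (le_abs_self _)) hc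
      have h5 : 0 ≤ c * |R + 1| := by positivity
      constructor <;> linarith [le_abs_self (g x), le_abs_self N, le_abs_self c', abs_nonneg c']
  exact ⟨L, fun b _ hbR => hL b (mem_closedBall_zero_iff.2 hbR)⟩

lemma isDCOn_comp_of_finiteDimensional [FiniteDimensional ℝ Y] {A : Set X} {B : Set Y}
    (hA : IsOpen A) (hAconv : Convex ℝ A) (hB : IsOpen B) {F : X → Y} {G : Y → Z}
    (hFAB : MapsTo F A B) (hF : IsDCOn F A) (hG : IsDCOn G B) (hcl : closure (F '' A) ⊆ B) :
    IsDCOn (G ∘ F) A := by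
  obtain ⟨hGc, g, hg⟩ := hG
  refine hg.isDCOn_comp hA hAconv hFAB hF hGc fun R => ?_
  have : ProperSpace Y := FiniteDimensional.proper ℝ Y
  have hK : IsCompact (closure (F '' A) ∩ Metric.closedBall 0 R) :=
    (isCompact_closedBall 0 R).inter_left isClosed_closure
  obtain ⟨δ, hδ, hsub⟩ := hK.exists_cthickening_subset_open hB (inter_subset_left.trans hcl)
  have hKδ := hK.cthickening (r := δ)
  obtain ⟨M₁, hM₁⟩ := hKδ.exists_bound_of_continuousOn (hGc.mono hsub)
  obtain ⟨M₂, hM₂⟩ := hKδ.exists_bound_of_continuousOn (hg.1.mono hsub)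
  obtain ⟨L, hL⟩ := hg.exists_sub_le_of_bounded
    (S := closure (F '' A) ∩ Metric.closedBall 0 R) (M := max M₁ M₂) hδ
    (fun b hb => (Metric.closedBall_subset_cthickening hb δ).trans hsub) fun b hb x hx => by
      have hx' := Metric.closedBall_subset_cthickening hb δ hx
      exact ⟨(hM₁ x hx').trans (le_max_left _ _), (hM₂ x hx').trans (le_max_right _ _)⟩
  exact ⟨L, fun b hb hbR => hL b ⟨subset_closure hb, mem_closedBall_zero_iff.2 hbR⟩⟩

end Control

/-! ### Power type 2 norms, `C^{1,1}` mappings and case (c). -/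

section UniformConvexity

variable {Y Z : Type*} [NormedAddCommGroup Y] [NormedSpace ℝ Y]
  [NormedAddCommGroup Z] [NormedSpace ℝ Z]

lemma le_of_le_modulusOfConvexity {p : Seminorm ℝ Y} {c ε : ℝ}
    (h : (c : EReal) ≤ modulusOfConvexity p ε) {x y : Y} (hx : p x = 1) (hy : p y = 1)
    (hxy : ε ≤ p (x - y)) : p ((1 / 2 : ℝ) • (x + y)) ≤ 1 - c := by
  have h1 : modulusOfConvexity p ε ≤ ((1 - p ((1 / 2 : ℝ) • (x + y)) : ℝ) : EReal) :=
    iInf_le_of_le x (iInf_le_of_le y (iInf_le_of_le hx (iInf_le_of_le hy (iInf_le _ hxy))))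
  have := EReal.coe_le_coe_iff.1 (h.trans h1)
  linarith

lemma HasConvexityPowerTypeTwo.exists_sq_midpoint_le_of_le_one {p : Seminorm ℝ Y}
    (h : HasConvexityPowerTypeTwo p) :
    ∃ c : ℝ, 0 < c ∧ ∀ x y : Y, p x = 1 → p y ≤ 1 →
      p ((1 / 2 : ℝ) • (x + y)) ^ 2 + c * p (x - y) ^ 2 ≤ (p x ^ 2 + p y ^ 2) / 2 := by
  obtain ⟨a, ha, hmod⟩ := h
  -- If `D / 2 ≤ 1 - s`, the gap `(1 - s)²/4` already gives `D²/16`. Otherwise `s > 1/3` and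
  -- normalising `y` keeps the distance at least `D / 2`; the modulus gains `aD²/12`, and the factor
  -- `(1 + s)/2 + m ≥ 1/2` leaves `aD²/24`.
  refine ⟨min (1 / 16) (a / 24), by positivity, fun x y hx hy => ?_⟩
  have hc1 := min_le_left (1 / 16 : ℝ) (a / 24)
  have hc2 := min_le_right (1 / 16 : ℝ) (a / 24)
  set c := min (1 / 16 : ℝ) (a / 24)
  set s := p y with hs
  set D := p (x - y) with hD
  have hs0 : 0 ≤ s := apply_nonneg p y
  have hD0 : 0 ≤ D := apply_nonneg p _
  have hDle : D ≤ 1 + s := by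
    have := map_sub_le_add p x y
    linarith
  have hm0 : 0 ≤ p ((1 / 2 : ℝ) • (x + y)) := apply_nonneg p _
  have hhalf : ∀ z : Y, p ((1 / 2 : ℝ) • z) = p z / 2 := fun z => by
    rw [map_smul_eq_mul]; norm_num; ring
  have hm1 : p ((1 / 2 : ℝ) • (x + y)) ≤ (1 + s) / 2 := by
    have := map_add_le_add p x y
    rw [hhalf]
    linarith
  rw [hx]
  rcases le_or_gt (D / 2) (1 - s) with hcase | hcase
  · have h1 : p ((1 / 2 : ℝ) • (x + y)) ^ 2 ≤ ((1 + s) / 2) ^ 2 := pow_le_pow_left₀ hm0 hm1 2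
    have h2 : (D / 2) ^ 2 ≤ (1 - s) ^ 2 := pow_le_pow_left₀ (by positivity) hcase 2
    have h3 : c * D ^ 2 ≤ 1 / 16 * D ^ 2 := mul_le_mul_of_nonneg_right hc1 (sq_nonneg D)
    nlinarith
  · have hs3 : 1 / 3 < s := by linarith
    have hspos : 0 < s := by linarith
    have hD1 : 0 < D := by linarith
    have hy' : p (s⁻¹ • y) = 1 := by
      rw [map_smul_eq_mul, norm_inv, Real.norm_of_nonneg hs0, ← hs, inv_mul_cancel₀ hspos.ne']
    have hyy : p (s⁻¹ • y - y) = 1 - s := by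
      have e : s⁻¹ • y - y = (1 - s) • (s⁻¹ • y) := by
        match_scalars; field_simp
      rw [e, map_smul_eq_mul, hy', Real.norm_of_nonneg (by linarith), mul_one]
    have hxy' : D / 2 ≤ p (x - s⁻¹ • y) := by
      have := map_add_le_add p (x - s⁻¹ • y) (s⁻¹ • y - y)
      rw [sub_add_sub_cancel, hyy] at this
      linarith
    have hmid := le_of_le_modulusOfConvexity (hmod (D / 2) (by positivity) (by linarith)) hx hy'
      hxy'
    have hle : p ((1 / 2 : ℝ) • (x + y)) ≤ (1 + s) / 2 - s * (a * (D / 2) ^ 2) := by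
      have e : (1 / 2 : ℝ) • (x + y) =
          s • ((1 / 2 : ℝ) • (x + s⁻¹ • y)) + ((1 - s) / 2) • x := by
        match_scalars
        · ring
        · field_simp
      have h1 := map_add_le_add p (s • ((1 / 2 : ℝ) • (x + s⁻¹ • y))) (((1 - s) / 2) • x)
      rw [← e, map_smul_eq_mul p s, map_smul_eq_mul p ((1 - s) / 2), hx,
        Real.norm_of_nonneg hs0, Real.norm_of_nonneg (by linarith)] at h1
      have h2 := mul_le_mul_of_nonneg_left hmid hs0
      linarith
    set m := p ((1 / 2 : ℝ) • (x + y))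
    have hq : a * D ^ 2 / 12 ≤ s * (a * (D / 2) ^ 2) := by
      have : 0 ≤ a * (D / 2) ^ 2 := by positivity
      nlinarith
    have h4 : a * D ^ 2 / 12 * (1 / 2) ≤ ((1 + s) / 2 - m) * ((1 + s) / 2 + m) :=
      mul_le_mul (by linarith) (by linarith) (by norm_num) (by linarith)
    have h3 : c * D ^ 2 ≤ a / 24 * D ^ 2 := mul_le_mul_of_nonneg_right hc2 (sq_nonneg D)
    nlinarith [sq_nonneg (1 - s)]

/-- The square of a norm with modulus of convexity of power type 2 is strongly midpoint convex. -/
lemma HasConvexityPowerTypeTwo.exists_sq_midpoint_le {p : Seminorm ℝ Y}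
    (h : HasConvexityPowerTypeTwo p) :
    ∃ c : ℝ, 0 < c ∧ ∀ x y : Y,
      p ((1 / 2 : ℝ) • (x + y)) ^ 2 + c * p (x - y) ^ 2 ≤ (p x ^ 2 + p y ^ 2) / 2 := by
  obtain ⟨c, hc, hle⟩ := h.exists_sq_midpoint_le_of_le_one
  refine ⟨c, hc, ?_⟩
  have key : ∀ x y : Y, p y ≤ p x →
      p ((1 / 2 : ℝ) • (x + y)) ^ 2 + c * p (x - y) ^ 2 ≤ (p x ^ 2 + p y ^ 2) / 2 := by
    intro x y hyx
    rcases (apply_nonneg p x).eq_or_lt with hx0 | hx0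
    · have hy0 : p y = 0 := le_antisymm (hx0 ▸ hyx) (apply_nonneg p y)
      have h1 : p (x + y) = 0 := le_antisymm
        ((map_add_le_add p x y).trans (by linarith)) (apply_nonneg p _)
      have h2 : p (x - y) = 0 := le_antisymm
        ((map_sub_le_add p x y).trans (by linarith)) (apply_nonneg p _)
      rw [map_smul_eq_mul, h1, h2, hy0, ← hx0]
      simp
    · have hscale : ∀ z : Y, p ((p x)⁻¹ • z) = (p x)⁻¹ * p z := fun z => by
        rw [map_smul_eq_mul, norm_inv, Real.norm_of_nonneg hx0.le]
      have := hle ((p x)⁻¹ • x) ((p x)⁻¹ • y)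
        (by rw [hscale, inv_mul_cancel₀ hx0.ne'])
        (by rw [hscale, inv_mul_le_iff₀ hx0, mul_one]; exact hyx)
      rw [← smul_add, ← smul_sub, smul_comm, hscale, hscale, hscale, hscale] at this
      have h2 := mul_le_mul_of_nonneg_left this (sq_nonneg (p x))
      have hne := hx0.ne'
      calc _ = p x ^ 2 * (((p x)⁻¹ * p ((1 / 2 : ℝ) • (x + y))) ^ 2
                + c * ((p x)⁻¹ * p (x - y)) ^ 2) := by field_simp
        _ ≤ _ := h2
        _ = _ := by field_simp
  intro x y
  rcases le_total (p y) (p x) with hxy | hxy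
  · exact key x y hxy
  · have := key y x hxy
    rw [add_comm y x, map_sub_rev p y x] at this
    linarith

/-- The first-order Taylor terms at `v` and `-v` cancel, leaving quadratic remainders. -/
lemma IsC11On.exists_norm_midpoint_sub_le {G : Y → Z} {U : Set Y} (h : IsC11On G U)
    (hU : IsOpen U) : ∃ K : ℝ, 0 ≤ K ∧ ∀ y ∈ U, ∀ᶠ v in 𝓝 (0 : Y),
      ‖(1 / 2 : ℝ) • (G (y + v) + G (y - v)) - G y‖ ≤ K * ‖v‖ ^ 2 := by
  obtain ⟨hd, K, hK⟩ := h
  refine ⟨K, K.2, fun y hy => ?_⟩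
  obtain ⟨r, hr, hball⟩ := Metric.isOpen_iff.1 hU y hy
  have htaylor : ∀ v : Y, ‖v‖ < r → ‖G (y + v) - G y - fderiv ℝ G y v‖ ≤ K * ‖v‖ ^ 2 := by
    intro v hv
    have hsubset : segment ℝ y (y + v) ⊆ U := by
      refine ((convex_ball y r).segment_subset (Metric.mem_ball_self hr) ?_).trans hball
      rw [mem_ball_iff_norm]; simpa using hv
    have := (convex_segment y (y + v)).norm_image_sub_le_of_norm_fderiv_le' (𝕜 := ℝ)
      (f := G) (φ := fderiv ℝ G y) (C := K * ‖v‖) (fun z hz => hd z (hsubset hz))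
      (fun z hz => ?_) (left_mem_segment ℝ y (y + v)) (right_mem_segment ℝ y (y + v))
    · rw [add_sub_cancel_left] at this
      rw [sq, ← mul_assoc]
      exact this
    · refine (hK.norm_sub_le (hsubset hz) hy).trans ?_
      have := norm_sub_le_of_mem_segment hz
      rw [add_sub_cancel_left] at this
      gcongr
  filter_upwards [Metric.ball_mem_nhds (0 : Y) hr] with v hv
  have hv' : ‖v‖ < r := mem_ball_zero_iff.1 hv
  have h1 := htaylor v hv'
  have h2 := htaylor (-v) (by rwa [norm_neg])
  rw [← sub_eq_add_neg, norm_neg, map_neg] at h2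
  have e : (1 / 2 : ℝ) • (G (y + v) + G (y - v)) - G y =
      (1 / 2 : ℝ) • ((G (y + v) - G y - fderiv ℝ G y v)
        + (G (y - v) - G y - -fderiv ℝ G y v)) := by module
  have h3 := norm_add_le (G (y + v) - G y - fderiv ℝ G y v) (G (y - v) - G y - -fderiv ℝ G y v)
  rw [e, norm_smul, Real.norm_of_nonneg (by norm_num)]
  linarith

lemma IsC11On.exists_norm_sub_le {G : Y → Z} {U : Set Y} (h : IsC11On G U)
    (hU : Bornology.IsBounded U) : ∃ L : ℝ, ∀ b ∈ U, ∀ᶠ y in 𝓝 b,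
      ‖G y - G b‖ ≤ L * ‖y - b‖ := by
  obtain ⟨hd, K, hK⟩ := h
  rcases U.eq_empty_or_nonempty with rfl | ⟨b₀, hb₀⟩
  · exact ⟨0, by simp⟩
  obtain ⟨D, hD⟩ := Metric.isBounded_iff.1 hU
  -- A Lipschitz derivative is bounded on a bounded set; the `+ 1` absorbs the little-o remainder.
  refine ⟨‖fderiv ℝ G b₀‖ + K * D + 1, fun b hb => ?_⟩
  have hCb : ‖fderiv ℝ G b‖ ≤ ‖fderiv ℝ G b₀‖ + K * D := by
    have h1 := hK.norm_sub_le hb hb₀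
    have h2 := mul_le_mul_of_nonneg_left (hD hb hb₀) K.coe_nonneg
    rw [dist_eq_norm] at h2
    have h3 := norm_add_le (fderiv ℝ G b - fderiv ℝ G b₀) (fderiv ℝ G b₀)
    rw [sub_add_cancel] at h3
    linarith
  filter_upwards [(hd b hb).hasFDerivAt.isLittleO.def one_pos] with y hy
  have h1 := (fderiv ℝ G b).le_of_opNorm_le hCb (y - b)
  have h2 := norm_add_le (G y - G b - fderiv ℝ G b (y - b)) (fderiv ℝ G b (y - b))
  rw [sub_add_cancel] at h2
  linarith

lemma isDCOn_comp_of_C11 {X : Type*} [NormedAddCommGroup X] [NormedSpace ℝ X] {A : Set X}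
    {B : Set Y} (hA : IsOpen A) (hAconv : Convex ℝ A) (hB : IsOpen B) (hBconv : Convex ℝ B)
    {F : X → Y} {G : Y → Z} (hFAB : MapsTo F A B) (hF : IsDCOn F A) (hG : ContinuousOn G B)
    {p : Seminorm ℝ Y} (hp : IsEquivalentNorm p) (hp2 : HasConvexityPowerTypeTwo p)
    (hC11 : ∀ U : Set Y, U ⊆ B → IsOpen U → Bornology.IsBounded U → IsC11On G U) :
    IsDCOn (G ∘ F) A := by
  obtain ⟨m, M, hm, hM, hpe⟩ := hp
  obtain ⟨c, hc, hstrong⟩ := hp2.exists_sq_midpoint_le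
  have hBR : ∀ R : ℝ, IsC11On G (B ∩ Metric.ball 0 R) := fun R =>
    hC11 _ inter_subset_left (hB.inter Metric.isOpen_ball)
      (Metric.isBounded_ball.subset inter_subset_right)
  have hpLip : ∀ x y : Y, |p x - p y| ≤ M * ‖x - y‖ := fun x y =>
    (abs_sub_map_le_sub p x y).trans (hpe _).2
  have hpc : Continuous p := by
    refine (LipschitzWith.of_dist_le_mul (K := ⟨M, hM.le⟩) fun x y => ?_).continuous
    rw [Real.dist_eq, dist_eq_norm]
    exact hpLip x y
  -- This radius captures every `y ∈ B` with `p y ^ 2 ≤ n`, since `m‖y‖ ≤ p y` and `‖y‖ < ‖y‖² + 1`.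
  choose K hK0 hK using fun n : ℕ => (hBR (n / m ^ 2 + 1)).exists_norm_midpoint_sub_le
    (hB.inter Metric.isOpen_ball)
  obtain ⟨θ, k, hθ, hkmono, hk0, hkL, hsub⟩ :=
    -- The midpoint defect of `p²` for `y ± v` is at least `c p(2v)² ≥ 4cm²‖v‖²`, hence the divisor.
    exists_continuous_large_subgradient fun n => K n / (4 * c * m ^ 2)
  have hgc : Continuous fun y => θ (p y ^ 2) := hθ.comp (hpc.pow 2)
  have hnorm : ∀ y : Y, ‖y‖ < (⌈p y ^ 2⌉₊ : ℝ) / m ^ 2 + 1 := fun y => by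
    have h1 : (m * ‖y‖) ^ 2 ≤ ⌈p y ^ 2⌉₊ :=
      (pow_le_pow_left₀ (by positivity) (hpe y).1 2).trans (Nat.le_ceil _)
    have h2 : ‖y‖ ^ 2 ≤ (⌈p y ^ 2⌉₊ : ℝ) / m ^ 2 := by
      rw [le_div_iff₀ (by positivity)]
      linarith [mul_pow m ‖y‖ 2]
    nlinarith [sq_nonneg (‖y‖ - 1 / 2)]
  have hcontrol : IsControlFunctionOn (fun y => θ (p y ^ 2)) G B := by
    refine ⟨hgc.continuousOn, fun φ hφ => ?_⟩
    refine convexOn_of_local_midpoint hBconv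
      ((φ.continuous.comp_continuousOn hG).add hgc.continuousOn) fun y hy => ?_
    filter_upwards [hK _ y ⟨hy, mem_ball_zero_iff.2 (hnorm y)⟩] with v hv
    have h1 := hsub (p y ^ 2) (p (y + v) ^ 2)
    have h2 := hsub (p y ^ 2) (p (y - v) ^ 2)
    have h3 := hstrong (y + v) (y - v)
    have e1 : (1 / 2 : ℝ) • (y + v + (y - v)) = y := by module
    have e2 : y + v - (y - v) = (2 : ℝ) • v := by module
    rw [e1, e2, map_smul_eq_mul, Real.norm_of_nonneg zero_le_two] at h3
    have h4 : (m * ‖v‖) ^ 2 ≤ p v ^ 2 := pow_le_pow_left₀ (by positivity) (hpe v).1 2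
    have h5 := hkL (p y ^ 2)
    rw [div_le_iff₀ (by positivity)] at h5
    have h6 : 4 * c * m ^ 2 * ‖v‖ ^ 2 ≤ (p (y + v) ^ 2 + p (y - v) ^ 2) / 2 - p y ^ 2 := by
      nlinarith
    have h7 := mul_le_mul_of_nonneg_left h6 (hk0 (p y ^ 2))
    have h8 := mul_le_mul_of_nonneg_right h5 (sq_nonneg ‖v‖)
    have h9 := (abs_le.1 ((abs_dual_le_norm hφ _).trans hv)).1
    simp only [map_sub, map_smul, map_add, smul_eq_mul] at h9
    linarith
  refine hcontrol.isDCOn_comp hA hAconv hFAB hF hG fun R => ?_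
  obtain ⟨L, hL⟩ := (hBR (R + 1)).exists_norm_sub_le
    (Metric.isBounded_ball.subset inter_subset_right)
  -- `L` handles `G`; the other term bounds the drop of `θ(p²)` through `p(b)² - p(y)² = (p b - p
  -- y)(p b + p y)`.
  refine ⟨L + k ((M * R) ^ 2) * (M * (M * (2 * R + 1))), fun b hb hbR => ?_⟩
  obtain ⟨x, hx, rfl⟩ := hb
  set b := F x
  filter_upwards [hL b ⟨hFAB hx, mem_ball_zero_iff.2 (by linarith)⟩,
    Metric.ball_mem_nhds b one_pos] with y hy hyb φ hφ
  have hy1 : ‖y‖ ≤ R + 1 := by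
    have h1 := mem_ball_iff_norm.1 hyb
    have h3 := norm_add_le (y - b) b
    rw [sub_add_cancel] at h3
    linarith
  have h1 := (abs_le.1 ((abs_dual_le_norm hφ _).trans hy)).1
  rw [map_sub] at h1
  have h2 := hsub (p b ^ 2) (p y ^ 2)
  have hpb : p b ≤ M * R := (hpe b).2.trans (by gcongr)
  have hpy : p y ≤ M * (R + 1) := (hpe y).2.trans (by gcongr)
  have h3 : p b ^ 2 - p y ^ 2 ≤ M * ‖y - b‖ * (M * (2 * R + 1)) := by
    have h4 := (le_abs_self _).trans (hpLip b y)
    rw [norm_sub_rev] at h4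
    calc p b ^ 2 - p y ^ 2 = (p b - p y) * (p b + p y) := by ring
      _ ≤ M * ‖y - b‖ * (p b + p y) :=
        mul_le_mul_of_nonneg_right h4 (add_nonneg (apply_nonneg p b) (apply_nonneg p y))
      _ ≤ _ := mul_le_mul_of_nonneg_left (by linarith) (by positivity)
  have hkb : k (p b ^ 2) ≤ k ((M * R) ^ 2) :=
    hkmono (pow_le_pow_left₀ (apply_nonneg p b) hpb 2)
  have hR : 0 ≤ R := (norm_nonneg b).trans hbR
  have h5 := (mul_le_mul_of_nonneg_left h3 (hk0 (p b ^ 2))).trans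
    (mul_le_mul_of_nonneg_right hkb (by positivity))
  linarith

end UniformConvexity

theorem theorem2p6 {X Y Z : Type*}
    [NormedAddCommGroup X] [NormedSpace ℝ X]
    [NormedAddCommGroup Y] [NormedSpace ℝ Y]
    [NormedAddCommGroup Z] [NormedSpace ℝ Z]
    (A : Set X) (B : Set Y)
    (hAopen : IsOpen A) (hAconv : Convex ℝ A) (hBopen : IsOpen B) (hBconv : Convex ℝ B)
    (F : X → Y) (G : Y → Z) (hFAB : Set.MapsTo F A B)
    (hF : IsDCOn F A) (hG : IsDCOn G B)
    (h :
      (B = Set.univ ∧ ∃ g : Y → ℝ, IsControlFunctionOn g G B ∧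
          ∀ S : Set Y, Bornology.IsBounded S → Bornology.IsBounded (g '' S)) ∨
      (FiniteDimensional ℝ Y ∧ closure (F '' A) ⊆ B) ∨
      ((∃ p : Seminorm ℝ Y, IsEquivalentNorm p ∧ HasConvexityPowerTypeTwo p) ∧
          ∀ U : Set Y, U ⊆ B → IsOpen U → Bornology.IsBounded U → IsC11On G U)) :
    IsDCOn (G ∘ F) A := by
  rcases h with ⟨rfl, g, hg, hb⟩ | ⟨_, hcl⟩ | ⟨⟨p, hp, hp2⟩, hC11⟩
  · exact isDCOn_comp_of_bounded_control hAopen hAconv hF hG.1 hg hb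
  · exact isDCOn_comp_of_finiteDimensional hAopen hAconv hBopen hFAB hF hG hcl
  · exact isDCOn_comp_of_C11 hAopen hAconv hBopen hBconv hFAB hF hG.1 hp hp2 hC11
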